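/- All graphs are finite and simple. For a graph $G$ and $T\subseteq V(G)$ let $c_G(T)$ be the number of connected components of the graph $G\setminus T$ obtained by deleting the vertices of $T$. The set $T$ is a cutset of $G$ if $c_G(T\setminus\{v\})<c_G(T)$ for every $v\in T$, and a vertex $v$ is a cutpoint of $G$ if $\{v\}$ is a cutset. Fix a field $\mathbb{K}$. The binomial edge ideal $J_G$ is the ideal of $\mathbb{K}[x_v,y_v : v\in V(G)]$ generated by the binomials $x_uy_v-x_vy_u$ with $\{u,v\}\in E(G)$. The graph $G$ is accessible if $J_G$ is unmixed (all its associated primes have the same height) and every non-empty cutset $T$ of $G$ contains some $t$ such that $T\setminus\{t\}$ is again a cutset. A block of $G$ is a connected induced subgraph without cutpoints that is maximal with this property. For a block $B$ of $G$, let $\overline{B}$ be the graph obtained from $B$ by adding, for every cutpoint $w$ of $G$ that lies in $B$, a new vertex $f_w$ and the edge $\{w,f_w\}$. A vertex of $B$ is pivotal if its degree in $B$ is at least $3$. A line of length $i$ between two pivotal vertices $a\ne b$ of $B$ is a path of length $i$ in $B$ from $a$ to $b$ none of whose interior vertices is pivotal. The cycle rank of $B$ is $m(B)=|E(B)|-|V(B)|+1$.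 Lemma. Let $G$ be an accessible graph, let $B$ be a block of $G$, and let $a,b$ be two pivotal vertices of $B$ that are connected by a line $L$ of length $i\ge 2$. Then exactly one of $a,b$ is a cutpoint of $\overline{B}$. Moreover: (1) $i<4$; (2) if $i=3$, then exactly one of the two interior vertices of $L$ is a cutpoint of $\overline{B}$, and it is adjacent to the one of $a,b$ that is a cutpoint of $\overline{B}$; (3) if $m(B)\ge 3$, then there is no line from $a$ to $b$ of length $2$ or $3$ other than $L$. -/

import Mathlib

namespace SimpleGraph

section Ideals

variable {V : Type*} (K : Type*) [Field K]

/-- The binomial edge ideal `J_G` in the polynomial ring over `K` with the variables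
`x_v = X (Sum.inl v)` and `y_v = X (Sum.inr v)`, generated by `x_u y_v - x_v y_u` for the
edges `{u, v}` of `G`. (Exchanging `u` and `v` only changes the sign of a generator.) -/
noncomputable def binomialEdgeIdeal (G : SimpleGraph V) : Ideal (MvPolynomial (V ⊕ V) K) :=
  Ideal.span {f | ∃ u v : V, G.Adj u v ∧
    f = MvPolynomial.X (Sum.inl u) * MvPolynomial.X (Sum.inr v)
      - MvPolynomial.X (Sum.inl v) * MvPolynomial.X (Sum.inr u)}

end Ideals

/-- An ideal is unmixed if all its associated primes have the same height. -/
def IsUnmixedIdeal {R : Type*} [CommRing R] (I : Ideal R) : Prop :=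
  ∀ P ∈ associatedPrimes R (R ⧸ I), ∀ Q ∈ associatedPrimes R (R ⧸ I), P.height = Q.height

section Cutsets

variable {V : Type*}

/-- `c_G(T)`: the number of connected components of the graph obtained from `G` by
removing the vertices of `T`. -/
noncomputable def numComponents (G : SimpleGraph V) (T : Set V) : ℕ :=
  Nat.card (G.induce Tᶜ).ConnectedComponent

/-- `T` is a cutset of `G` if `c_G(T \ {v}) < c_G(T)` for each `v ∈ T`. -/
def IsCutset (G : SimpleGraph V) (T : Set V) : Prop :=
  ∀ v ∈ T, G.numComponents (T \ {v}) < G.numComponents T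

/-- `v` is a cutpoint of `G` if `{v}` is a cutset of `G`. -/
def IsCutpoint (G : SimpleGraph V) (v : V) : Prop :=
  G.IsCutset {v}

/-- `G` is accessible (over `K`) if its binomial edge ideal is unmixed and its cutsets form an
accessible set system: every non-empty cutset stays a cutset after removing a suitable element. -/
def IsAccessible (K : Type*) [Field K] (G : SimpleGraph V) : Prop :=
  IsUnmixedIdeal (G.binomialEdgeIdeal K) ∧
    ∀ T : Set V, G.IsCutset T → T.Nonempty → ∃ t ∈ T, G.IsCutset (T \ {t})

/-- `B` is (the vertex set of) a block of `G`: the subgraph induced by `B` is connected, has no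
cutpoint, and `B` is maximal with respect to this property. -/
def IsBlock (G : SimpleGraph V) (B : Set V) : Prop :=
  Maximal (fun C : Set V => (G.induce C).Connected ∧ ∀ v, ¬ (G.induce C).IsCutpoint v) B

/-- The block with whiskers `B̄`: to the subgraph induced by `B` one adds, for each cutpoint `w`
of `G` in `B`, a new vertex `f_w = Sum.inr w` and the single edge `{w, f_w}`. -/
def blockWithWhiskers (G : SimpleGraph V) (B : Set V) :
    SimpleGraph (B ⊕ {w : B // G.IsCutpoint (w : V)}) where
  Adj
    | Sum.inl u, Sum.inl v => G.Adj u v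
    | Sum.inl u, Sum.inr w => u = w.1
    | Sum.inr w, Sum.inl u => u = w.1
    | Sum.inr _, Sum.inr _ => False
  symm := ⟨by
    rintro (u | w) (v | z) h
    · exact G.adj_symm h
    · exact h
    · exact h
    · exact h⟩
  loopless := ⟨by
    rintro (u | w) h
    · exact G.loopless.irrefl _ h
    · exact h⟩

/-- The cycle rank `m(H) = |E(H)| - |V(H)| + 1` of a connected finite graph. -/
noncomputable def cycleRank (H : SimpleGraph V) : ℤ :=
  (Nat.card H.edgeSet : ℤ) - (Nat.card V : ℤ) + 1

/-- A vertex of a finite graph is pivotal if its degree is at least 3. -/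
def IsPivotal (H : SimpleGraph V) (v : V) : Prop :=
  3 ≤ (H.neighborSet v).ncard

/-- A line of `H` from `a` to `b`: a path between two pivotal vertices none of whose interior
vertices is pivotal. -/
structure IsLine (H : SimpleGraph V) {a b : V} (p : H.Walk a b) : Prop where
  isPath : p.IsPath
  ne : a ≠ b
  pivotal_left : H.IsPivotal a
  pivotal_right : H.IsPivotal b
  interior : ∀ v ∈ p.support, v ≠ a → v ≠ b → ¬ H.IsPivotal v

end Cutsets

end SimpleGraph

/-! Unmixedness enters only through the inequality c(T) ≤ |T| + c(∅) for cutsets T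
(`IsUnmixedIdeal.numComponents_le`). A cutset T gives a minimal prime P_T of J_G, the kernel of an
explicit homomorphism. Krull's height theorem yields ht P_T ≤ |V| + |T| - c(T), a chain of primes
yields ht P_∅ ≥ |V| - c(∅), and the two heights agree.

Let u ≠ w in B be such that B \ {u, w} is disconnected. Since B has no cutpoint, u and w each have a
neighbour in every component, and paths of G between vertices of B stay in B; so {u, w} is a cutset
of G, and accessibility makes u or w a cutpoint. If both were cutpoints, or if B \ {u, w} had three
components, deleting first a cutpoint and then the other vertex would create at least 1 + 2 new
components, against the inequality. Hence exactly one is a cutpoint (`IsBlock.xor_isCutpoint`), and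
there are at most two components (`IsBlock.false_of_three`).

Two vertices of L at distance at least 2 along L form such a pair: what lies between them has degree
at most 2 and is cut off from a neighbour of a outside L. The first claim, (1) and (2) follow by
comparing such pairs. For (3), a second short line is internally disjoint from L, so either B \ {a,
b} has a third component, or the two lines cover B and counting degrees gives m(B) ≤ 2. -/

namespace SimpleGraph

/-! ### Reachability inside a set of vertices -/

section ReachIn

variable {V : Type*} {G : SimpleGraph V} {A A' : Set V} {x y z v : V}

/-- `y` can be reached from `x` by a walk of `G` all of whose vertices lie in `A`. -/
def ReachIn (G : SimpleGraph V) (A : Set V) (x y : V) : Prop :=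
  ∃ p : G.Walk x y, ∀ z ∈ p.support, z ∈ A

theorem ReachIn.left_mem (h : G.ReachIn A x y) : x ∈ A :=
  let ⟨p, hp⟩ := h; hp _ p.start_mem_support

theorem ReachIn.right_mem (h : G.ReachIn A x y) : y ∈ A :=
  let ⟨p, hp⟩ := h; hp _ p.end_mem_support

theorem ReachIn.refl (h : x ∈ A) : G.ReachIn A x x :=
  ⟨Walk.nil, by simpa using h⟩

theorem ReachIn.symm (h : G.ReachIn A x y) : G.ReachIn A y x :=
  let ⟨p, hp⟩ := h; ⟨p.reverse, by simpa using hp⟩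

theorem ReachIn.trans (h : G.ReachIn A x y) (h' : G.ReachIn A y z) : G.ReachIn A x z := by
  obtain ⟨p, hp⟩ := h
  obtain ⟨q, hq⟩ := h'
  refine ⟨p.append q, fun w hw => ?_⟩
  rcases (Walk.mem_support_append_iff _ _).1 hw with h | h
  exacts [hp _ h, hq _ h]

theorem ReachIn.of_adj (h : G.Adj x y) (hx : x ∈ A) (hy : y ∈ A) : G.ReachIn A x y :=
  ⟨h.toWalk, by simp [hx, hy]⟩

theorem ReachIn.mono (hA : A ⊆ A') (h : G.ReachIn A x y) : G.ReachIn A' x y :=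
  let ⟨p, hp⟩ := h; ⟨p, fun w hw => hA (hp w hw)⟩

theorem ReachIn.exists_isPath (h : G.ReachIn A x y) :
    ∃ p : G.Walk x y, p.IsPath ∧ ∀ z ∈ p.support, z ∈ A := by
  classical
  obtain ⟨p, hp⟩ := h
  exact ⟨p.bypass, p.bypass_isPath, fun z hz => hp z (p.support_bypass_subset_support hz)⟩

theorem reachable_induce_iff (hx : x ∈ A) (hy : y ∈ A) :
    (G.induce A).Reachable ⟨x, hx⟩ ⟨y, hy⟩ ↔ G.ReachIn A x y := by
  constructor
  · rintro ⟨p⟩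
    refine ⟨p.map (Embedding.induce A).toHom, fun z hz => ?_⟩
    obtain ⟨w, -, rfl⟩ := List.mem_map.1
      ((congrArg (z ∈ ·) (Walk.support_map (Embedding.induce A).toHom p)).mp hz)
    exact w.2
  · rintro ⟨p, hp⟩
    exact ⟨p.induce A hp⟩

theorem reachIn_induce_iff {C : Set V} {A : Set C} {x y : C} :
    (G.induce C).ReachIn A x y ↔ G.ReachIn ((↑) '' A) (x : V) y := by
  constructor
  · rintro ⟨p, hp⟩
    refine ⟨p.map (Embedding.induce C).toHom, fun z hz => ?_⟩
    obtain ⟨w, hw, rfl⟩ := List.mem_map.1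
      ((congrArg (z ∈ ·) (Walk.support_map (Embedding.induce C).toHom p)).mp hz)
    exact ⟨w, hp w hw, rfl⟩
  · rintro ⟨p, hp⟩
    have hC : ∀ z ∈ p.support, z ∈ C := fun z hz => by
      obtain ⟨w, -, rfl⟩ := hp z hz
      exact w.2
    refine ⟨p.induce C hC, fun z hz => ?_⟩
    rw [Walk.support_induce] at hz
    have : (z : V) ∈ p.support := by
      simpa using hz
    obtain ⟨w, hw, h⟩ := hp z this
    rwa [← Subtype.ext h]

/-- A set that a walk in `A` cannot leave contains everything reachable from it. -/
theorem ReachIn.mem_of_closed {C : Set V} (h : G.ReachIn A x y)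
    (hC : ∀ u ∈ C, ∀ w ∈ A, G.Adj u w → w ∈ C) (hx : x ∈ C) : y ∈ C := by
  obtain ⟨p, hp⟩ := h
  induction p with
  | nil => exact hx
  | cons h p ih =>
    exact ih (hC _ hx _ (hp _ (by simp)) h) fun z hz => hp z (by simp [hz])

/-- A walk to another vertex `v` passes, before it first reaches `v`, through a neighbour of `v`. -/
theorem ReachIn.exists_adj_of_ne (h : G.ReachIn A x v) (hne : x ≠ v) :
    ∃ y, G.Adj v y ∧ G.ReachIn (A \ {v}) x y := by
  obtain ⟨p, hp⟩ := h
  induction p with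
  | nil => exact absurd rfl hne
  | @cons a b c h p ih =>
    have ha : a ∈ A \ {c} := ⟨hp _ (by simp), hne⟩
    by_cases hb : b = c
    · subst hb
      exact ⟨a, h.symm, .refl ha⟩
    · obtain ⟨y, hy, hr⟩ := ih hb (fun z hz => hp z (by simp [hz]))
      exact ⟨y, hy, (ReachIn.of_adj h ha hr.left_mem).trans hr⟩

/-- If `y` is reachable in `A` but not in `A \ {v}`, then a neighbour of `v` is. -/
theorem ReachIn.exists_adj_or (h : G.ReachIn A x y) (hx : x ≠ v) :
    G.ReachIn (A \ {v}) x y ∨ ∃ w, G.Adj v w ∧ G.ReachIn (A \ {v}) x w := by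
  classical
  obtain ⟨p, hp⟩ := h
  by_cases hv : v ∈ p.support
  · exact .inr (ReachIn.exists_adj_of_ne
      ⟨p.takeUntil v hv, fun z hz => hp z (p.support_takeUntil_subset_support hv hz)⟩ hx)
  · exact .inl ⟨p, fun z hz => ⟨hp z hz, fun h => hv (h ▸ hz)⟩⟩

/-- If all neighbours of `v` in `A` can be connected in `A \ {v}`, then `v` can be avoided. -/
theorem ReachIn.sdiff_of_forall (h : G.ReachIn A x y) (hx : x ≠ v) (hy : y ≠ v)
    (hv : ∀ w ∈ A, ∀ z ∈ A, G.Adj v w → G.Adj v z → G.ReachIn (A \ {v}) w z) :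
    G.ReachIn (A \ {v}) x y := by
  rcases h.exists_adj_or hx with h' | ⟨w, hw, hxw⟩
  · exact h'
  rcases h.symm.exists_adj_or hy with h' | ⟨z, hz, hyz⟩
  · exact h'.symm
  exact (hxw.trans (hv w hxw.right_mem.1 z hyz.right_mem.1 hw hz)).trans hyz.symm

theorem ReachIn.map {W : Type*} {H : SimpleGraph W} (f : G →g H) {S : Set W}
    (h : G.ReachIn A x y) (hf : ∀ z ∈ A, f z ∈ S) : H.ReachIn S (f x) (f y) := by
  obtain ⟨p, hp⟩ := h
  refine ⟨p.map f, fun z hz => ?_⟩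
  obtain ⟨w, hw, rfl⟩ := List.mem_map.1 ((congrArg (z ∈ ·) (Walk.support_map f p)).mp hz)
  exact hf w (hp w hw)

end ReachIn

/-! ### Counting components; cutsets in terms of separated neighbours -/

section Counting

variable {V : Type*} {G : SimpleGraph V} {T : Set V} {v : V}

/-- The map on components induced by putting back a deleted vertex. -/
noncomputable def componentsRestore (G : SimpleGraph V) (T : Set V) (v : V) :
    (G.induce (insert v T)ᶜ).ConnectedComponent → (G.induce Tᶜ).ConnectedComponent :=
  ConnectedComponent.map
    (G.induceHomOfLE (Set.compl_subset_compl.2 (Set.subset_insert v T))).toHom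

theorem compl_insert_eq : (insert v T)ᶜ = Tᶜ \ {v} := by
  ext z; simp [not_or, and_comm]

/-- Only the component of `v` could be missed, and it contains the surviving neighbour `y`. -/
theorem componentsRestore_surjective {y : V} (hy : y ∈ (insert v T)ᶜ) (hv : v ∉ T)
    (hvy : G.Adj v y) : Function.Surjective (G.componentsRestore T v) := by
  intro c
  induction c using ConnectedComponent.ind with | _ x
  obtain ⟨x, hx⟩ := x
  by_cases hxv : x = v
  · subst hxv
    refine ⟨(G.induce _).connectedComponentMk ⟨y, hy⟩, ?_⟩
    have hyT : y ∈ Tᶜ := fun h => hy (.inr h)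
    exact ConnectedComponent.eq.2 ((reachable_induce_iff hyT hx).2 (.of_adj hvy.symm hyT hx))
  · exact ⟨(G.induce _).connectedComponentMk ⟨x, by simp_all⟩, rfl⟩

/-- If a vertex `v` has `k + 1` neighbours in different components of the graph without `v`, then
removing `v` increases the number of components by at least `k`. -/
theorem numComponents_add_le [Finite V] {k : ℕ} (hv : v ∉ T) (f : Fin (k + 1) → V)
    (hf : ∀ i, G.Adj v (f i)) (hT : ∀ i, f i ∉ T)
    (hr : ∀ i j, i ≠ j → ¬ G.ReachIn (insert v T)ᶜ (f i) (f j)) :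
    G.numComponents T + k ≤ G.numComponents (insert v T) := by
  classical
  have hm : ∀ i, f i ∈ (insert v T)ᶜ := fun i h => by
    rcases h with h | h
    · exact G.loopless.irrefl _ (h ▸ hf i)
    · exact hT i h
  have hs := componentsRestore_surjective (hm 0) hv (hf 0)
  let g := Function.surjInv hs
  let c₀ := (G.induce Tᶜ).connectedComponentMk ⟨v, hv⟩
  have hc : ∀ i, G.componentsRestore T v
      ((G.induce (insert v T)ᶜ).connectedComponentMk ⟨f i, hm i⟩) = c₀ := fun i =>
    ConnectedComponent.eq.2 ((reachable_induce_iff (hT i) hv).2 (.of_adj (hf i).symm (hT i) hv))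
  -- One preimage for each component other than that of `v`, and the `k + 1` separated components
  -- lying over that of `v`.
  let F : {c // c ≠ c₀} ⊕ Fin (k + 1) → (G.induce (insert v T)ᶜ).ConnectedComponent :=
    Sum.elim (fun c => g c.1) fun i => (G.induce _).connectedComponentMk ⟨f i, hm i⟩
  have hF : Function.Injective F := by
    rintro (c | i) (d | j) h
    · exact congrArg Sum.inl (Subtype.ext (Function.injective_surjInv hs h))
    · exact absurd ((Function.surjInv_eq hs c.1).symm.trans
        ((congrArg (G.componentsRestore T v) h).trans (hc j))) c.2
    · exact absurd ((Function.surjInv_eq hs d.1).symm.trans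
        ((congrArg (G.componentsRestore T v) h.symm).trans (hc i))) d.2
    · by_contra hij
      exact hr i j (fun e => hij (congrArg _ e))
        ((reachable_induce_iff (hm i) (hm j)).1 (ConnectedComponent.eq.1 h))
  have h1 := Nat.card_le_card_of_injective F hF
  have h2 : Nat.card {c // c ≠ c₀} + 1 = Nat.card (G.induce Tᶜ).ConnectedComponent := by
    have := Fintype.ofFinite (G.induce Tᶜ).ConnectedComponent
    have h3 : 0 < Fintype.card (G.induce Tᶜ).ConnectedComponent := Fintype.card_pos_iff.2 ⟨c₀⟩
    rw [Nat.card_eq_fintype_card, Nat.card_eq_fintype_card, Fintype.card_subtype_compl,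
      Fintype.card_subtype_eq]
    omega
  rw [Nat.card_sum, Nat.card_fin] at h1
  unfold numComponents
  omega

/-- If no two neighbours of `v` are separated, every walk through `v` can be rerouted, so restoring
`v` merges no components. -/
theorem numComponents_lt_iff [Finite V] (hv : v ∉ T) :
    G.numComponents T < G.numComponents (insert v T) ↔
      ∃ x y, G.Adj v x ∧ G.Adj v y ∧ x ∉ T ∧ y ∉ T ∧ ¬ G.ReachIn (insert v T)ᶜ x y := by
  constructor
  · intro h
    by_contra! hn
    refine h.not_ge (Nat.card_le_card_of_injective (G.componentsRestore T v) fun c d hcd => ?_)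
    induction c using ConnectedComponent.ind with | _ x
    induction d using ConnectedComponent.ind with | _ y
    obtain ⟨x, hx⟩ := x
    obtain ⟨y, hy⟩ := y
    have hxT : x ∉ T := fun h => hx (.inr h)
    have hyT : y ∉ T := fun h => hy (.inr h)
    have h1 : G.ReachIn Tᶜ x y := (reachable_induce_iff hxT hyT).1 (ConnectedComponent.eq.1 hcd)
    refine ConnectedComponent.eq.2 ((reachable_induce_iff hx hy).2 ?_)
    rw [compl_insert_eq] at hn ⊢
    exact h1.sdiff_of_forall (fun h => hx (.inl h)) (fun h => hy (.inl h))
      fun w hw z hz hvw hvz => hn w z hvw hvz hw hz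
  · rintro ⟨x, y, hx, hy, hxT, hyT, h⟩
    have := G.numComponents_add_le (k := 1) hv ![x, y] (by simp [Fin.forall_fin_two, hx, hy])
      (by simp [Fin.forall_fin_two, hxT, hyT])
      (by simpa [Fin.forall_fin_two, h] using fun h' => h (ReachIn.symm h'))
    omega

theorem isCutset_iff [Finite V] : G.IsCutset T ↔ ∀ v ∈ T, ∃ x y, G.Adj v x ∧ G.Adj v y ∧
    x ∉ T ∧ y ∉ T ∧ ¬ G.ReachIn Tᶜ x y := by
  refine forall₂_congr fun v hv => ?_
  have := G.numComponents_lt_iff (T := T \ {v}) (v := v) (by simp)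
  rw [Set.insert_sdiff_singleton, Set.insert_eq_of_mem hv] at this
  rw [this]
  refine exists₂_congr fun x y => and_congr_right fun hx => and_congr_right fun hy => ?_
  simp [hx.ne', hy.ne']

theorem isCutpoint_iff [Finite V] : G.IsCutpoint v ↔ ∃ x y, G.Adj v x ∧ G.Adj v y ∧
    ¬ G.ReachIn {v}ᶜ x y := by
  rw [IsCutpoint, isCutset_iff]
  simp only [Set.mem_singleton_iff, forall_eq]
  refine exists₂_congr fun x y => and_congr_right fun hx => and_congr_right fun hy => ?_
  simp [hx.ne', hy.ne']

end Counting

/-! ### Primes attached to vertex labellings, and their heights -/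

section LabelIdeal

open MvPolynomial

variable {V ι : Type*} (K : Type*) [Field K] (l : V → Option ι)

/-- For a partial labelling `l` of the vertices, the homomorphism `x_v ↦ s_v`, `y_v ↦ s_v t_{l v}`
that sends the variables of the unlabelled vertices to `0`. -/
noncomputable def labelHom : MvPolynomial (V ⊕ V) K →ₐ[K] MvPolynomial (V ⊕ ι) K :=
  aeval (Sum.elim (fun v => (l v).elim 0 fun _ => X (Sum.inl v))
    fun v => (l v).elim 0 fun c => X (Sum.inl v) * X (Sum.inr c))

/-- The prime ideal attached to a partial labelling of the vertices: it is generated by the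
variables of the unlabelled vertices and by the binomials of the pairs with equal labels. -/
noncomputable def labelIdeal : Ideal (MvPolynomial (V ⊕ V) K) :=
  RingHom.ker (labelHom K l)

instance : (labelIdeal K l).IsPrime := RingHom.ker_isPrime _

/-- The binomial `x_u y_v - x_v y_u`. -/
noncomputable def edgeBinomial (u v : V) : MvPolynomial (V ⊕ V) K :=
  X (Sum.inl u) * X (Sum.inr v) - X (Sum.inl v) * X (Sum.inr u)

variable {K l}

@[simp] theorem labelHom_X_inl (v : V) :
    labelHom K l (X (Sum.inl v)) = (l v).elim 0 fun _ => X (Sum.inl v) := by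
  simp [labelHom]

@[simp] theorem labelHom_X_inr (v : V) :
    labelHom K l (X (Sum.inr v)) = (l v).elim 0 fun c => X (Sum.inl v) * X (Sum.inr c) := by
  simp [labelHom]

theorem X_inl_mem_labelIdeal_iff {v : V} :
    X (Sum.inl v) ∈ labelIdeal K l ↔ l v = none := by
  rw [labelIdeal, RingHom.mem_ker, labelHom_X_inl]
  cases l v <;> simp

theorem X_inr_mem_labelIdeal {v : V} (h : l v = none) :
    X (Sum.inr v) ∈ labelIdeal K l := by
  rw [labelIdeal, RingHom.mem_ker, labelHom_X_inr, h, Option.elim_none]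

theorem edgeBinomial_mem_labelIdeal_iff {u v : V} :
    edgeBinomial K u v ∈ labelIdeal K l ↔ l u = none ∨ l v = none ∨ l u = l v := by
  rw [labelIdeal, RingHom.mem_ker, edgeBinomial, map_sub, map_mul, map_mul]
  simp only [labelHom_X_inl, labelHom_X_inr]
  cases hu : l u with
  | none => simp
  | some c =>
    cases hv : l v with
    | none => simp
    | some d =>
      have : (X (Sum.inl u) * (X (Sum.inl v) * X (Sum.inr d)) -
          X (Sum.inl v) * (X (Sum.inl u) * X (Sum.inr c)) : MvPolynomial (V ⊕ ι) K) =
          X (Sum.inl u) * X (Sum.inl v) * (X (Sum.inr d) - X (Sum.inr c)) := by ring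
      simp only [Option.elim_some, this, mul_eq_zero, X_ne_zero, sub_eq_zero, false_or,
        X_inj, Sum.inr.injEq, reduceCtorEq, Option.some.injEq]
      exact eq_comm

/-- The relation `x_u y_v - x_v y_u ∈ Q` is transitive through vertices `v` with `x_v ∉ Q`. -/
theorem edgeBinomial_mem_trans {Q : Ideal (MvPolynomial (V ⊕ V) K)} [Q.IsPrime] {u v w : V}
    (hv : X (Sum.inl v) ∉ Q) (huv : edgeBinomial K u v ∈ Q) (hvw : edgeBinomial K v w ∈ Q) :
    edgeBinomial K u w ∈ Q := by
  refine (Ideal.IsPrime.mem_or_mem ‹_› (?_ : X (Sum.inl v) * edgeBinomial K u w ∈ Q)).resolve_left hv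
  have : X (Sum.inl v) * edgeBinomial K u w =
      X (Sum.inl u) * edgeBinomial K v w + X (Sum.inl w) * edgeBinomial K u v := by
    simp only [edgeBinomial]; ring
  rw [this]
  exact Q.add_mem (Q.mul_mem_left _ hvw) (Q.mul_mem_left _ huv)

theorem edgeBinomial_mem_symm {Q : Ideal (MvPolynomial (V ⊕ V) K)} {u v : V}
    (h : edgeBinomial K u v ∈ Q) : edgeBinomial K v u ∈ Q := by
  have : edgeBinomial K v u = -edgeBinomial K u v := by simp only [edgeBinomial]; ring
  rw [this]
  exact Q.neg_mem h

/-- The quotient map modulo `Q`, followed into the fraction field, factors through `labelHom`; hence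
the kernel of `labelHom` lies in `Q`. -/
theorem labelIdeal_le {Q : Ideal (MvPolynomial (V ⊕ V) K)} [hQ : Q.IsPrime]
    (hle : Q ≤ labelIdeal K l)
    (h0 : ∀ v, l v = none → X (Sum.inl v) ∈ Q ∧ X (Sum.inr v) ∈ Q)
    (h1 : ∀ u v c, l u = some c → l v = some c → edgeBinomial K u v ∈ Q) :
    labelIdeal K l ≤ Q := by
  classical
  let F := FractionRing (MvPolynomial (V ⊕ V) K ⧸ Q)
  let π : MvPolynomial (V ⊕ V) K →+* F := (algebraMap (MvPolynomial (V ⊕ V) K ⧸ Q) F).comp (Ideal.Quotient.mk Q)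
  have hπ : ∀ f, π f = 0 ↔ f ∈ Q := fun f => by
    rw [← Ideal.Quotient.eq_zero_iff_mem]
    exact map_eq_zero_iff (algebraMap (MvPolynomial (V ⊕ V) K ⧸ Q) F) (IsFractionRing.injective _ F)
  -- `t_c` goes to the ratio `y / x` at a chosen vertex of label `c`, where `x ∉ Q` by `hle`; a
  -- label that does not occur gets the irrelevant value `0`.
  let ψ : MvPolynomial (V ⊕ ι) K →+* F := eval₂Hom (π.comp C) (Sum.elim (fun v => π (X (Sum.inl v)))
    fun c => if h : ∃ r, l r = some c then π (X (Sum.inr h.choose)) / π (X (Sum.inl h.choose))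
      else 0)
  have hcomp : ψ.comp (labelHom K l : MvPolynomial (V ⊕ V) K →+* _) = π := by
    refine MvPolynomial.ringHom_ext (fun k => ?_) ?_
    · simp [ψ, labelHom]
    · rintro (v | v)
      · cases hv : l v with
        | none => simp [hv, (hπ _).2 (h0 v hv).1]
        | some c => simp [hv, ψ]
      · cases hv : l v with
        | none => simp [hv, (hπ _).2 (h0 v hv).2]
        | some c =>
          have hex : ∃ r, l r = some c := ⟨v, hv⟩
          have hr := hex.choose_spec
          have hx : π (X (Sum.inl hex.choose)) ≠ 0 := fun h => by
            have := X_inl_mem_labelIdeal_iff.1 (hle ((hπ _).1 h))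
            simp [hr] at this
          have he := (hπ _).2 (h1 v hex.choose c hv hr)
          simp only [edgeBinomial, map_sub, map_mul, sub_eq_zero] at he
          simp only [ψ, RingHom.comp_apply, RingHom.coe_coe, labelHom_X_inr, hv, Option.elim_some,
            map_mul, coe_eval₂Hom, eval₂_X, Sum.elim_inl, Sum.elim_inr, dif_pos hex]
          rw [← mul_div_assoc, he, mul_div_cancel_left₀ _ hx]
  intro f hf
  rw [← hπ, ← hcomp, RingHom.comp_apply]
  rw [labelIdeal, RingHom.mem_ker] at hf
  simp [hf]

theorem labelIdeal_mono {κ : Type*} (g : κ → ι) {m : V → Option κ}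
    (h : ∀ v, l v = (m v).map g) : labelIdeal K m ≤ labelIdeal K l := by
  have hcomp : (rename (Sum.map id g)).comp (labelHom K m) = labelHom K l := by
    refine MvPolynomial.algHom_ext ?_
    rintro (v | v) <;> cases hv : m v <;> simp [h, hv]
  intro f hf
  rw [labelIdeal, RingHom.mem_ker] at hf ⊢
  rw [← hcomp, AlgHom.comp_apply, hf, map_zero]

/-- While two vertices share a label, giving one of them a new label makes the prime strictly
smaller; this builds a chain of primes. -/
theorem card_le_height_labelIdeal_add [Finite V] (l : V → ι) :
    (Nat.card V : ℕ∞) ≤ (labelIdeal K (some ∘ l)).height + (Set.range l).ncard := by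
  classical
  obtain ⟨d, hd⟩ : ∃ d, d = Nat.card V - (Set.range l).ncard := ⟨_, rfl⟩
  induction d generalizing ι with
  | zero =>
    exact le_add_left (by exact_mod_cast Nat.sub_eq_zero_iff_le.1 hd.symm)
  | succ d ih =>
    have hni : ¬ Function.Injective l := fun h => by
      rw [← Set.image_univ, Set.ncard_image_of_injective _ h, Set.ncard_univ] at hd
      omega
    rw [Function.Injective] at hni
    push Not at hni
    obtain ⟨u, v, huv, hne⟩ := hni
    -- Here `none` is the new label of `u`, not the mark of an unlabelled vertex: the ideal used is
    -- that of `some ∘ m`.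
    let m : V → Option ι := fun w => if w = u then none else some (l w)
    have hrange : Set.range m = insert none (some '' Set.range l) := by
      ext (_ | c)
      · simp only [Set.mem_range, Set.mem_insert_iff, true_or, iff_true]
        exact ⟨u, by simp [m]⟩
      · simp only [Set.mem_range, Set.mem_insert_iff, reduceCtorEq, false_or, Set.mem_image,
          Option.some.injEq, exists_eq_right]
        constructor
        · rintro ⟨w, hw⟩
          refine ⟨w, ?_⟩
          by_cases h : w = u <;> simp_all [m]
        · rintro ⟨w, rfl⟩
          by_cases h : w = u
          · exact ⟨v, by simp [m, hne.symm, h, huv]⟩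
          · exact ⟨w, by simp [m, h]⟩
    have hcard : (Set.range m).ncard = (Set.range l).ncard + 1 := by
      rw [hrange, Set.ncard_insert_of_notMem (by simp) (Set.toFinite _),
        Set.ncard_image_of_injective _ (Option.some_injective _)]
    have hlt : labelIdeal K (some ∘ m) < labelIdeal K (some ∘ l) := by
      refine lt_of_le_of_ne (labelIdeal_mono (fun o => o.getD (l u)) fun w => ?_) fun h => ?_
      · by_cases h : w = u <;> simp [m, h]
      · have h1 : edgeBinomial K u v ∈ labelIdeal K (some ∘ l) := by
          rw [edgeBinomial_mem_labelIdeal_iff]; simp [huv]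
        rw [← h, edgeBinomial_mem_labelIdeal_iff] at h1
        simp [m, hne.symm] at h1
    have h1 := ih m (by omega)
    have h2 := Ideal.height_add_one_le_of_lt_of_isPrime hlt
    calc _ ≤ _ := h1
      _ = ((labelIdeal K (some ∘ m)).height + 1) + (Set.range l).ncard := by
        rw [hcard]; push_cast; ring
      _ ≤ _ := by gcongr

/-- Krull's height theorem: the prime is minimal over the ideal generated by both variables of each
unlabelled vertex and, for each label `c`, the binomials joining the root `r c` to the other
vertices of that label. -/
theorem height_labelIdeal_add_le [Finite V] (r : ι → V) (hr : ∀ c, l (r c) = some c) :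
    (labelIdeal K l).height + Nat.card ι ≤ Nat.card V + {v | l v = none}.ncard := by
  classical
  have hinj : Function.Injective r := fun c d h => by
    have := hr c
    rw [h, hr d] at this
    exact (Option.some_injective _ this).symm
  let g : V → MvPolynomial (V ⊕ V) K := fun v =>
    (l v).elim (X (Sum.inl v)) fun c => edgeBinomial K (r c) v
  let S := g '' (Set.range r)ᶜ ∪ (fun v => X (Sum.inr v)) '' {v | l v = none}
  have hSle : Ideal.span S ≤ labelIdeal K l := by
    rw [Ideal.span_le]
    rintro _ (⟨v, -, rfl⟩ | ⟨v, hv, rfl⟩)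
    · cases hv : l v with
      | none => simpa [g, hv] using X_inl_mem_labelIdeal_iff.2 hv
      | some c => simpa [g, hv] using edgeBinomial_mem_labelIdeal_iff.2 (by simp [hr, hv])
    · exact X_inr_mem_labelIdeal hv
  have hmin : labelIdeal K l ∈ (Ideal.span S).minimalPrimes := by
    refine ⟨⟨inferInstance, hSle⟩, fun Q ⟨hQ, hSQ⟩ hle => ?_⟩
    rw [Ideal.span_le] at hSQ
    have hroot : ∀ v c, l v = some c → edgeBinomial K (r c) v ∈ Q := fun v c hv => by
      by_cases h : v ∈ Set.range r
      · obtain ⟨d, rfl⟩ := h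
        obtain rfl : d = c := Option.some_injective _ ((hr d).symm.trans hv)
        simp [edgeBinomial]
      · simpa [g, hv] using hSQ (.inl ⟨v, h, rfl⟩)
    refine labelIdeal_le hle (fun v hv => ⟨?_, hSQ (.inr ⟨v, hv, rfl⟩)⟩) fun u v c hu hv => ?_
    · have h : v ∉ Set.range r := by
        rintro ⟨c, rfl⟩
        simp [hr] at hv
      simpa [g, hv] using hSQ (.inl ⟨v, h, rfl⟩)
    · refine edgeBinomial_mem_trans (v := r c) (fun h => ?_)
        (edgeBinomial_mem_symm (hroot u c hu)) (hroot v c hv)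
      have := X_inl_mem_labelIdeal_iff.1 (hle h)
      simp [hr] at this
  have hfin : S.Finite := (Set.toFinite _).union (Set.toFinite _)
  have hcard : S.ncard + Nat.card ι ≤ Nat.card V + {v | l v = none}.ncard := by
    have h1 : S.ncard ≤ ((Set.range r)ᶜ).ncard + {v | l v = none}.ncard :=
      (Set.ncard_union_le _ _).trans
        (add_le_add (Set.ncard_image_le (Set.toFinite _)) (Set.ncard_image_le (Set.toFinite _)))
    have h2 := Set.ncard_add_ncard_compl (Set.range r)
    have h3 : (Set.range r).ncard = Nat.card ι := by
      rw [← Set.image_univ, Set.ncard_image_of_injective _ hinj, Set.ncard_univ]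
    omega
  have hht := Ideal.height_le_spanRank_toENat_of_mem_minimalPrimes _ _ hmin
  have hsp : (Ideal.span S).spanRank.toENat ≤ S.ncard := by
    have := Submodule.spanRank_span_le_card (R := MvPolynomial (V ⊕ V) K) S
    rw [← Set.cast_ncard hfin] at this
    simpa using Cardinal.toENat.monotone' this
  calc _ ≤ (S.ncard : ℕ∞) + Nat.card ι := by gcongr; exact hht.trans hsp
    _ ≤ _ := by exact_mod_cast hcard

end LabelIdeal

/-! ### Minimal primes from cutsets, and the bound from unmixedness -/

section Unmixed

open MvPolynomial

variable {V : Type*} {K : Type*} [Field K] {G : SimpleGraph V} {T : Set V}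

open Classical in
/-- The vertices outside `T`, labelled by their component of `G \ T`. -/
noncomputable def componentLabel (G : SimpleGraph V) (T : Set V) (v : V) :
    Option (G.induce Tᶜ).ConnectedComponent :=
  if h : v ∈ T then none else some ((G.induce Tᶜ).connectedComponentMk ⟨v, h⟩)

theorem componentLabel_eq_none_iff {v : V} : G.componentLabel T v = none ↔ v ∈ T := by
  by_cases h : v ∈ T <;> simp [componentLabel, h]

theorem componentLabel_eq_iff {u v : V} (hu : u ∉ T) (hv : v ∉ T) :
    G.componentLabel T u = G.componentLabel T v ↔ G.ReachIn Tᶜ u v := by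
  simp [componentLabel, hu, hv, ConnectedComponent.eq, reachable_induce_iff]

theorem edgeBinomial_mem_of_reachIn {Q : Ideal (MvPolynomial (V ⊕ V) K)} [Q.IsPrime]
    (hJ : G.binomialEdgeIdeal K ≤ Q) (hT : ∀ v ∉ T, X (Sum.inl v) ∉ Q) {u v : V}
    (h : G.ReachIn Tᶜ u v) : edgeBinomial K u v ∈ Q := by
  obtain ⟨p, hp⟩ := h
  induction p with
  | nil => simp [edgeBinomial]
  | @cons a b c h p ih =>
    exact edgeBinomial_mem_trans (hT b (hp b (by simp)))
      (hJ (Ideal.subset_span ⟨a, b, h, rfl⟩)) (ih fun z hz => hp z (by simp [hz]))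

/-- Let `Q` be a prime between the two ideals. If `x_v ∉ Q` for some `v ∈ T`, transitivity through
`v` would put the binomial of two neighbours separated by `T` into `Q`, although it is not in the
larger ideal. -/
theorem labelIdeal_mem_minimalPrimes [Finite V] (hT : G.IsCutset T) :
    labelIdeal K (G.componentLabel T) ∈ (G.binomialEdgeIdeal K).minimalPrimes := by
  refine ⟨⟨inferInstance, Ideal.span_le.2 ?_⟩, fun Q ⟨hQ, hJ⟩ hle => ?_⟩
  · rintro _ ⟨u, v, h, rfl⟩
    refine edgeBinomial_mem_labelIdeal_iff.2 ?_
    by_cases hu : u ∈ T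
    · exact .inl (componentLabel_eq_none_iff.2 hu)
    by_cases hv : v ∈ T
    · exact .inr (.inl (componentLabel_eq_none_iff.2 hv))
    · exact .inr (.inr ((componentLabel_eq_iff hu hv).2 (.of_adj h hu hv)))
  have hX : ∀ v ∉ T, X (Sum.inl v) ∉ Q := fun v hv h =>
    hv (componentLabel_eq_none_iff.1 (X_inl_mem_labelIdeal_iff.1 (hle h)))
  refine labelIdeal_le hle (fun v hv => ?_) fun u v c hu hv => ?_
  · rw [componentLabel_eq_none_iff] at hv
    obtain ⟨x, y, hx, hy, hxT, hyT, hxy⟩ := isCutset_iff.1 hT v hv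
    have hmx : edgeBinomial K x v ∈ Q := hJ (Ideal.subset_span ⟨x, v, hx.symm, rfl⟩)
    have hmy : edgeBinomial K v y ∈ Q := hJ (Ideal.subset_span ⟨v, y, hy, rfl⟩)
    have hv0 : X (Sum.inl v) ∈ Q := by
      by_contra hv0
      have := edgeBinomial_mem_labelIdeal_iff.1 (hle (edgeBinomial_mem_trans hv0 hmx hmy))
      rw [componentLabel_eq_none_iff, componentLabel_eq_none_iff,
        componentLabel_eq_iff hxT hyT] at this
      tauto
    refine ⟨hv0, (hQ.mem_or_mem (?_ : X (Sum.inl x) * X (Sum.inr v) ∈ Q)).resolve_left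
      (hX x hxT)⟩
    exact (Q.sub_mem_iff_left (Q.mul_mem_right _ hv0)).1 hmx
  · have hu' : u ∉ T := fun h => by simp [componentLabel_eq_none_iff.2 h] at hu
    have hv' : v ∉ T := fun h => by simp [componentLabel_eq_none_iff.2 h] at hv
    exact edgeBinomial_mem_of_reachIn hJ hX ((componentLabel_eq_iff hu' hv').1 (hu.trans hv.symm))

/-- The primes of `T` and of the cutset `∅` are associated primes, so the upper height bound for the
first meets the lower bound for the second. -/
theorem IsUnmixedIdeal.numComponents_le [Finite V]
    (hG : IsUnmixedIdeal (G.binomialEdgeIdeal K)) (hT : G.IsCutset T) :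
    G.numComponents T ≤ T.ncard + G.numComponents ∅ := by
  have hass : ∀ {S : Set V}, G.IsCutset S → labelIdeal K (G.componentLabel S) ∈
      associatedPrimes _ (MvPolynomial (V ⊕ V) K ⧸ G.binomialEdgeIdeal K) := fun hS => by
    have := labelIdeal_mem_minimalPrimes (K := K) hS
    rw [← Ideal.annihilator_quotient (I := G.binomialEdgeIdeal K)] at this
    exact Module.associatedPrimes.minimalPrimes_annihilator_subset_associatedPrimes _ _ this
  have heq := hG _ (hass hT) _ (hass (S := ∅) (by simp [IsCutset]))
  have hup := height_labelIdeal_add_le (K := K) (l := G.componentLabel T)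
    (fun c => (c.out : V)) fun c => by
      have : (c.out : V) ∉ T := c.out.2
      simp only [componentLabel, this, dite_false, Option.some.injEq]
      exact c.out_eq
  have hlow := card_le_height_labelIdeal_add (K := K)
    (fun v => (G.induce (∅ : Set V)ᶜ).connectedComponentMk ⟨v, by simp⟩)
  have hl : G.componentLabel ∅ =
      some ∘ fun v => (G.induce (∅ : Set V)ᶜ).connectedComponentMk ⟨v, by simp⟩ := by
    ext1 v
    simp [componentLabel]
  rw [← hl, ← heq] at hlow
  have hrange : (Set.range fun v =>
      (G.induce (∅ : Set V)ᶜ).connectedComponentMk ⟨v, by simp⟩).ncard ≤ G.numComponents ∅ :=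
    Set.ncard_le_card _
  simp only [componentLabel_eq_none_iff, Set.ofPred_mem_eq] at hup
  have hne : (labelIdeal K (G.componentLabel T)).height ≠ ⊤ :=
    Ideal.height_ne_top (Ideal.IsPrime.ne_top inferInstance)
  lift (labelIdeal K (G.componentLabel T)).height to ℕ using hne with h
  norm_cast at hup hlow
  change h + G.numComponents T ≤ _ at hup
  omega

end Unmixed

/-! ### Blocks and their separating pairs -/

section Blocks

variable {V : Type*} [Finite V] {G : SimpleGraph V} {B : Set V}

theorem connected_and_forall_not_isCutpoint_iff {C : Set V} :
    ((G.induce C).Connected ∧ ∀ v, ¬ (G.induce C).IsCutpoint v) ↔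
      C.Nonempty ∧ (∀ x ∈ C, ∀ y ∈ C, G.ReachIn C x y) ∧
        ∀ v ∈ C, ∀ x ∈ C \ {v}, ∀ y ∈ C \ {v}, G.ReachIn (C \ {v}) x y := by
  have himg : ∀ v : C, ((↑) '' ({v}ᶜ : Set C) : Set V) = C \ {(v : V)} := fun v => by
    ext z; simp
  have hcut : ∀ v : C, (G.induce C).IsCutpoint v ↔ ∃ x ∈ C, ∃ y ∈ C, G.Adj v x ∧ G.Adj v y ∧
      ¬ G.ReachIn (C \ {(v : V)}) x y := fun v => by
    simp only [isCutpoint_iff, reachIn_induce_iff, himg, Subtype.exists, comap_adj,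
      Function.Embedding.subtype_apply, exists_prop]
  constructor
  · rintro ⟨hc, hn⟩
    have hr : ∀ x ∈ C, ∀ y ∈ C, G.ReachIn C x y := fun x hx y hy =>
      (reachable_induce_iff hx hy).1 (hc.preconnected _ _)
    refine ⟨Set.nonempty_coe_sort.1 hc.nonempty, hr, fun v hv x hx y hy => ?_⟩
    refine (hr x hx.1 y hy.1).sdiff_of_forall hx.2 hy.2 fun w hw z hz hvw hvz => ?_
    by_contra h
    exact hn ⟨v, hv⟩ ((hcut _).2 ⟨w, hw, z, hz, hvw, hvz, h⟩)
  · rintro ⟨hne, hr, hd⟩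
    have := hne.to_subtype
    refine ⟨⟨fun x y => (reachable_induce_iff x.2 y.2).2 (hr x x.2 y y.2)⟩, fun v hv => ?_⟩
    obtain ⟨x, hx, y, hy, hvx, hvy, h⟩ := (hcut v).1 hv
    exact h (hd v v.2 x ⟨hx, hvx.ne'⟩ y ⟨hy, hvy.ne'⟩)

theorem IsBlock.reachIn_sdiff (hB : G.IsBlock B) (v : V) {x y : V} (hx : x ∈ B \ {v})
    (hy : y ∈ B \ {v}) : G.ReachIn (B \ {v}) x y := by
  obtain ⟨-, hr, hd⟩ := connected_and_forall_not_isCutpoint_iff.1 hB.prop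
  by_cases hv : v ∈ B
  · exact hd v hv x hx y hy
  · have : B \ {v} = B := Set.sdiff_singleton_eq_self hv
    rw [this] at hx hy ⊢
    exact hr x hx y hy

/-- Every path between two vertices of a block stays in the block. -/
theorem IsBlock.mem_of_isPath (hB : G.IsBlock B) {x y z : V} (hx : x ∈ B) (hy : y ∈ B)
    {p : G.Walk x y} (hp : p.IsPath) (hz : z ∈ p.support) : z ∈ B := by
  classical
  obtain ⟨hne, hr, -⟩ := connected_and_forall_not_isCutpoint_iff.1 hB.prop
  set C : Set V := B ∪ {z | z ∈ p.support} with hC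
  have hBC : B ⊆ C := Set.subset_union_left
  have hpC : ∀ w ∈ p.support, w ∈ C := fun w hw => .inr hw
  suffices h : C ⊆ B from h (hpC z hz)
  -- By maximality it suffices that adding the path to `B` creates no cutpoint.
  refine hB.le_of_ge (connected_and_forall_not_isCutpoint_iff.2 ⟨hne.mono hBC, ?_, ?_⟩) hBC
  · have hto : ∀ w ∈ C, G.ReachIn C w x := by
      rintro w (hw | hw)
      · exact (hr w hw x hx).mono hBC
      · exact ReachIn.symm ⟨p.takeUntil w hw,
          fun s hs => hpC s (p.support_takeUntil_subset_support hw hs)⟩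
    exact fun w hw s hs => (hto w hw).trans (hto s hs).symm
  · intro v _
    have hto : ∀ w ∈ C \ {v}, ∃ t ∈ B \ {v}, G.ReachIn (C \ {v}) w t := by
      rintro w ⟨hw | hw, hwv⟩
      · exact ⟨w, ⟨hw, hwv⟩, .refl ⟨.inl hw, hwv⟩⟩
      -- The deleted vertex `v` lies on at most one side of `w` on the path, so `w` still reaches
      -- `B` along the other side.
      · by_cases hv : v ∈ (p.takeUntil w hw).support
        · have hv' : v ∉ (p.dropUntil w hw).support := fun h =>
            ((p.take_spec hw).symm ▸ hp).ne_of_mem_support_of_append (fun e => hwv e.symm) hv h rfl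
          exact ⟨y, ⟨hy, fun h => hv' (h ▸ Walk.end_mem_support _)⟩, p.dropUntil w hw,
            fun s hs => ⟨hpC s (p.support_dropUntil_subset_support hw hs), fun h => hv' (h ▸ hs)⟩⟩
        · exact ⟨x, ⟨hx, fun h => hv (h ▸ Walk.start_mem_support _)⟩, ReachIn.symm
            ⟨p.takeUntil w hw, fun s hs =>
              ⟨hpC s (p.support_takeUntil_subset_support hw hs), fun h => hv (h ▸ hs)⟩⟩⟩
    intro w hw s hs
    obtain ⟨t, ht, hwt⟩ := hto w hw
    obtain ⟨t', ht', hst⟩ := hto s hs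
    exact (hwt.trans ((hB.reachIn_sdiff v ht ht').mono
      (Set.sdiff_subset_sdiff_left hBC))).trans hst.symm

theorem IsBlock.reachIn_inter (hB : G.IsBlock B) {A : Set V} {x y : V} (h : G.ReachIn A x y)
    (hx : x ∈ B) (hy : y ∈ B) : G.ReachIn (B ∩ A) x y := by
  obtain ⟨p, hp, hA⟩ := h.exists_isPath
  exact ⟨p, fun z hz => ⟨hB.mem_of_isPath hx hy hp hz, hA z hz⟩⟩

/-- A cutpoint of `G` in a block has a neighbour that it separates from the block. -/
theorem IsBlock.exists_adj_not_reachIn (hB : G.IsBlock B) {u : V} (hu : G.IsCutpoint u) :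
    ∃ y, G.Adj u y ∧ ∀ b ∈ B \ {u}, ¬ G.ReachIn {u}ᶜ y b := by
  obtain ⟨x, y, hx, hy, hxy⟩ := isCutpoint_iff.1 hu
  by_contra! h
  obtain ⟨b, hb, hxb⟩ := h x hx
  obtain ⟨c, hc, hyc⟩ := h y hy
  exact hxy ((hxb.trans ((hB.reachIn_sdiff u hb hc).mono fun z hz => hz.2)).trans hyc.symm)

/-- Deleting `c` leaves the rest of the block connected, so only a whisker at `c` can be split off.
The second vertex `c'` provides something to split it from. -/
theorem IsBlock.isCutpoint_blockWithWhiskers_iff (hB : G.IsBlock B) {c c' : B} (hne : c' ≠ c) :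
    (G.blockWithWhiskers B).IsCutpoint (Sum.inl c) ↔ G.IsCutpoint (c : V) := by
  have hcc : (c' : V) ∈ B \ {(c : V)} := ⟨c'.2, fun h => hne (Subtype.ext h)⟩
  constructor
  · intro h
    by_contra hc
    obtain ⟨x | x, y | y, hx, hy, hxy⟩ := isCutpoint_iff.1 h
    · refine hxy ?_
      have hxy' : (G.induce B).ReachIn {c}ᶜ x y := by
        refine reachIn_induce_iff.2 ((hB.reachIn_sdiff c
          ⟨x.2, (G.ne_of_adj hx).symm⟩ ⟨y.2, (G.ne_of_adj hy).symm⟩).mono ?_)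
        exact fun z hz => ⟨⟨z, hz.1⟩, fun h => hz.2 (congrArg Subtype.val h), rfl⟩
      let f : G.induce B →g G.blockWithWhiskers B := ⟨Sum.inl, fun h => h⟩
      exact hxy'.map f fun z hz h => hz (Sum.inl_injective h)
    · exact hc ((show c = y.1 from hy) ▸ y.2)
    · exact hc ((show c = x.1 from hx) ▸ x.2)
    · exact hc ((show c = y.1 from hy) ▸ y.2)
  · intro h
    obtain ⟨-, hr, -⟩ := connected_and_forall_not_isCutpoint_iff.1 hB.prop
    obtain ⟨y, hy, hr⟩ := (hr c' c'.2 c c.2).exists_adj_of_ne hcc.2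
    let w : {w : B // G.IsCutpoint (w : V)} := ⟨c, h⟩
    refine isCutpoint_iff.2 ⟨Sum.inr w, Sum.inl ⟨y, hr.right_mem.1⟩, rfl, hy, fun hwy => ?_⟩
    have := hwy.mem_of_closed (C := {Sum.inr w}) ?_ rfl
    · simp at this
    · rintro _ rfl (z | z) hz hwz
      · exact absurd (congrArg Sum.inl (show z = c from hwz)) hz
      · exact hwz.elim

variable {u w : V}

/-- `B \ {u}` is connected, so `w` has a neighbour in every component of `B \ {u, w}`. -/
theorem IsBlock.exists_adj_reachIn (hB : G.IsBlock B) (hw : w ∈ B) (huw : u ≠ w) {x : V}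
    (hx : x ∈ B \ {u, w}) : ∃ y, G.Adj w y ∧ G.ReachIn (B \ {u, w}) x y := by
  simp only [Set.mem_sdiff, Set.mem_insert_iff, Set.mem_singleton_iff, not_or] at hx
  obtain ⟨y, hy, h⟩ := (hB.reachIn_sdiff u (x := x) ⟨hx.1, hx.2.1⟩ ⟨hw, huw.symm⟩).exists_adj_of_ne
    hx.2.2
  exact ⟨y, hy, h.mono fun z hz => by simp_all⟩

theorem IsBlock.not_reachIn_of_reachIn (hB : G.IsBlock B) {T : Set V} {x x' y y' : V}
    (hx : G.ReachIn (B \ T) x y) (hx' : G.ReachIn (B \ T) x' y')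
    (h : ¬ G.ReachIn (B \ T) x x') : ¬ G.ReachIn Tᶜ y y' := fun hy =>
  h ((hx.trans (hB.reachIn_inter hy hx.right_mem.1 hx'.right_mem.1)).trans hx'.symm)

theorem IsBlock.isCutset_pair (hB : G.IsBlock B) (hu : u ∈ B) (hw : w ∈ B) (huw : u ≠ w)
    {x₁ x₂ : V} (h₁ : x₁ ∈ B \ {u, w}) (h₂ : x₂ ∈ B \ {u, w})
    (h₁₂ : ¬ G.ReachIn (B \ {u, w}) x₁ x₂) : G.IsCutset {u, w} := by
  have key : ∀ u' w', u' ≠ w' → w' ∈ B → ({u', w'} : Set V) = {u, w} →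
      ∃ x y, G.Adj w' x ∧ G.Adj w' y ∧ x ∉ ({u, w} : Set V) ∧ y ∉ ({u, w} : Set V) ∧
        ¬ G.ReachIn ({u, w} : Set V)ᶜ x y := by
    intro u' w' hne hw' he
    rw [← he] at h₁ h₂ h₁₂ ⊢
    obtain ⟨y₁, hy₁, hr₁⟩ := hB.exists_adj_reachIn hw' hne h₁
    obtain ⟨y₂, hy₂, hr₂⟩ := hB.exists_adj_reachIn hw' hne h₂
    exact ⟨y₁, y₂, hy₁, hy₂, hr₁.right_mem.2, hr₂.right_mem.2,
      hB.not_reachIn_of_reachIn hr₁ hr₂ h₁₂⟩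
  rw [isCutset_iff]
  rintro v (rfl | rfl)
  · exact key w v huw.symm hu (Set.pair_comm _ _)
  · exact key u v huw hw rfl

/-- Deleting `u` adds at least one component and deleting `w` afterwards at least two, while `hU`
allows only two in all. -/
theorem not_isCutset_pair_of_three_adj
    (hU : ∀ T : Set V, G.IsCutset T → G.numComponents T ≤ T.ncard + G.numComponents ∅)
    (huw : u ≠ w) (hT : G.IsCutset {u, w})
    (hu : G.IsCutpoint u) {y₁ y₂ y₃ : V} (h₁ : G.Adj w y₁) (h₂ : G.Adj w y₂) (h₃ : G.Adj w y₃)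
    (hn₁ : y₁ ≠ u) (hn₂ : y₂ ≠ u) (hn₃ : y₃ ≠ u) (h₁₂ : ¬ G.ReachIn {u, w}ᶜ y₁ y₂)
    (h₁₃ : ¬ G.ReachIn {u, w}ᶜ y₁ y₃) (h₂₃ : ¬ G.ReachIn {u, w}ᶜ y₂ y₃) : False := by
  have h0 : G.numComponents ∅ < G.numComponents {u} := by
    simpa using hu u rfl
  have h1 := hU _ hT
  rw [Set.ncard_pair huw] at h1
  rw [Set.pair_comm u w] at h₁₂ h₁₃ h₂₃ h1
  have h2 := G.numComponents_add_le (k := 2) (T := {u}) (v := w) huw.symm ![y₁, y₂, y₃]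
    (by simp [Fin.forall_fin_succ, h₁, h₂, h₃]) (by simp [Fin.forall_fin_succ, hn₁, hn₂, hn₃]) (by
      have := mt ReachIn.symm h₁₂
      have := mt ReachIn.symm h₁₃
      have := mt ReachIn.symm h₂₃
      simp [Fin.forall_fin_succ, *])
  omega

/-- Besides neighbours in two components of `B \ {u, w}`, a cutpoint `w` has a neighbour cut off
from the block, which makes three. -/
theorem IsBlock.not_isCutpoint_and_isCutpoint
    (hU : ∀ T : Set V, G.IsCutset T → G.numComponents T ≤ T.ncard + G.numComponents ∅)
    (hB : G.IsBlock B) (hu : u ∈ B) (hw : w ∈ B)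
    (huw : u ≠ w) {x₁ x₂ : V} (h₁ : x₁ ∈ B \ {u, w}) (h₂ : x₂ ∈ B \ {u, w})
    (h₁₂ : ¬ G.ReachIn (B \ {u, w}) x₁ x₂) : ¬ (G.IsCutpoint u ∧ G.IsCutpoint w) := by
  rintro ⟨hcu, hcw⟩
  obtain ⟨y₁, hy₁, hr₁⟩ := hB.exists_adj_reachIn hw huw h₁
  obtain ⟨y₂, hy₂, hr₂⟩ := hB.exists_adj_reachIn hw huw h₂
  obtain ⟨y, hy, hr⟩ := hB.exists_adj_not_reachIn hcw
  have hsub : ({u, w}ᶜ : Set V) ⊆ {w}ᶜ := by simp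
  have hnr : ∀ z ∈ B \ {u, w}, ¬ G.ReachIn {u, w}ᶜ z y := fun z hz h =>
    hr z ⟨hz.1, fun h => hz.2 (.inr h)⟩ (h.symm.mono hsub)
  refine not_isCutset_pair_of_three_adj hU huw (hB.isCutset_pair hu hw huw h₁ h₂ h₁₂) hcu hy₁ hy₂
    hy (fun h => hr₁.right_mem.2 (.inl h)) (fun h => hr₂.right_mem.2 (.inl h)) ?_
    (hB.not_reachIn_of_reachIn hr₁ hr₂ h₁₂) (hnr _ hr₁.right_mem) (hnr _ hr₂.right_mem)
  rintro rfl
  exact hr y ⟨hu, huw⟩ (.refl huw)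

/-- Accessibility, applied to the cutset `{u, w}`, leaves a cutset with one element, that is, a
cutpoint. -/
theorem IsBlock.xor_isCutpoint
    (hU : ∀ T : Set V, G.IsCutset T → G.numComponents T ≤ T.ncard + G.numComponents ∅)
    (hA : ∀ T : Set V, G.IsCutset T → T.Nonempty → ∃ t ∈ T, G.IsCutset (T \ {t}))
    (hB : G.IsBlock B) (hu : u ∈ B) (hw : w ∈ B)
    (huw : u ≠ w) {x₁ x₂ : V} (h₁ : x₁ ∈ B \ {u, w}) (h₂ : x₂ ∈ B \ {u, w})
    (h₁₂ : ¬ G.ReachIn (B \ {u, w}) x₁ x₂) : Xor (G.IsCutpoint u) (G.IsCutpoint w) := by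
  have hn := hB.not_isCutpoint_and_isCutpoint hU hu hw huw h₁ h₂ h₁₂
  obtain ⟨t, rfl | rfl, ht⟩ := hA _ (hB.isCutset_pair hu hw huw h₁ h₂ h₁₂) ⟨u, by simp⟩
  · have : ({t, w} : Set V) \ {t} = {w} := by
      ext z; simp only [Set.mem_sdiff, Set.mem_insert_iff, Set.mem_singleton_iff]; grind
    rw [this] at ht
    exact .inr ⟨ht, fun h => hn ⟨h, ht⟩⟩
  · have : ({u, t} : Set V) \ {t} = {u} := by
      ext z; simp only [Set.mem_sdiff, Set.mem_insert_iff, Set.mem_singleton_iff]; grind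
    rw [this] at ht
    exact .inl ⟨ht, fun h => hn ⟨ht, h⟩⟩

theorem IsBlock.false_of_three
    (hU : ∀ T : Set V, G.IsCutset T → G.numComponents T ≤ T.ncard + G.numComponents ∅)
    (hA : ∀ T : Set V, G.IsCutset T → T.Nonempty → ∃ t ∈ T, G.IsCutset (T \ {t}))
    (hB : G.IsBlock B) (hu : u ∈ B) (hw : w ∈ B)
    (huw : u ≠ w) {x₁ x₂ x₃ : V} (h₁ : x₁ ∈ B \ {u, w}) (h₂ : x₂ ∈ B \ {u, w})
    (h₃ : x₃ ∈ B \ {u, w}) (h₁₂ : ¬ G.ReachIn (B \ {u, w}) x₁ x₂)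
    (h₁₃ : ¬ G.ReachIn (B \ {u, w}) x₁ x₃) (h₂₃ : ¬ G.ReachIn (B \ {u, w}) x₂ x₃) : False := by
  wlog hcu : G.IsCutpoint u generalizing u w
  · rw [Set.pair_comm u w] at *
    refine this hw hu huw.symm h₁ h₂ h₃ h₁₂ h₁₃ h₂₃ ?_
    exact ((hB.xor_isCutpoint hU hA hw hu huw.symm h₁ h₂ h₁₂).or).resolve_right hcu
  obtain ⟨y₁, hy₁, hr₁⟩ := hB.exists_adj_reachIn hw huw h₁
  obtain ⟨y₂, hy₂, hr₂⟩ := hB.exists_adj_reachIn hw huw h₂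
  obtain ⟨y₃, hy₃, hr₃⟩ := hB.exists_adj_reachIn hw huw h₃
  exact not_isCutset_pair_of_three_adj hU huw (hB.isCutset_pair hu hw huw h₁ h₂ h₁₂) hcu
    hy₁ hy₂ hy₃ (fun h => hr₁.right_mem.2 (.inl h)) (fun h => hr₂.right_mem.2 (.inl h))
    (fun h => hr₃.right_mem.2 (.inl h)) (hB.not_reachIn_of_reachIn hr₁ hr₂ h₁₂)
    (hB.not_reachIn_of_reachIn hr₁ hr₃ h₁₃) (hB.not_reachIn_of_reachIn hr₂ hr₃ h₂₃)

end Blocks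

/-! ### Lines and cycle rank -/

section Lines

variable {V : Type*} {H : SimpleGraph V} {a b : V} {p q : H.Walk a b}

theorem _root_.Set.ncard_pair_le_two {x y : V} : ({x, y} : Set V).ncard ≤ 2 :=
  (Set.ncard_insert_le _ _).trans (by simp)

theorem IsLine.getVert_inj (hp : H.IsLine p) {j k : ℕ} (hj : j ≤ p.length) (hk : k ≤ p.length) :
    p.getVert j = p.getVert k ↔ j = k :=
  ⟨fun h => hp.isPath.getVert_injOn hj hk h, fun h => h ▸ rfl⟩

theorem IsLine.not_isPivotal_getVert (hp : H.IsLine p) {j : ℕ} (h0 : 0 < j) (hj : j < p.length) :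
    ¬ H.IsPivotal (p.getVert j) :=
  hp.interior _ (p.getVert_mem_support j)
    (fun h => h0.ne' ((hp.isPath.getVert_eq_start_iff hj.le).1 h))
    fun h => hj.ne ((hp.isPath.getVert_eq_end_iff hj.le).1 h)

/-- A third neighbour would make an interior vertex pivotal. -/
theorem IsLine.eq_or_eq_of_adj [Finite V] (hp : H.IsLine p) {j : ℕ} (h0 : 0 < j) (hj : j < p.length) {z : V}
    (hz : H.Adj (p.getVert j) z) : z = p.getVert (j - 1) ∨ z = p.getVert (j + 1) := by
  by_contra! h
  refine hp.not_isPivotal_getVert h0 hj ?_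
  have hne : p.getVert (j - 1) ≠ p.getVert (j + 1) := fun e => by
    have := (hp.getVert_inj (by omega) (by omega)).1 e
    omega
  have h1 : H.Adj (p.getVert j) (p.getVert (j - 1)) := by
    have := p.adj_getVert_succ (i := j - 1) (by omega)
    rw [Nat.sub_add_cancel h0] at this
    exact this.symm
  have hsub : ({z, p.getVert (j - 1), p.getVert (j + 1)} : Set V) ⊆
      H.neighborSet (p.getVert j) := by
    rintro _ (rfl | rfl | rfl)
    exacts [hz, h1, p.adj_getVert_succ hj]
  have := Set.ncard_le_ncard hsub
  rwa [Set.ncard_eq_three.2 ⟨_, _, _, h.1, h.2, hne, rfl⟩] at this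

theorem IsLine.eq_one_of_adj_left [Finite V] (hp : H.IsLine p) {l : ℕ} (h0 : 0 < l) (hl : l < p.length)
    (h : H.Adj a (p.getVert l)) : l = 1 := by
  rcases hp.eq_or_eq_of_adj h0 hl h.symm with h | h
  · have := (hp.isPath.getVert_eq_start_iff (i := l - 1) (by omega)).1 h.symm
    omega
  · have := (hp.isPath.getVert_eq_start_iff (i := l + 1) (by omega)).1 h.symm
    omega

theorem IsLine.add_one_eq_length_of_adj_right [Finite V] (hp : H.IsLine p) {l : ℕ} (h0 : 0 < l)
    (hl : l < p.length) (h : H.Adj b (p.getVert l)) : l + 1 = p.length := by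
  rcases hp.eq_or_eq_of_adj h0 hl h.symm with h | h
  · have := (hp.isPath.getVert_eq_end_iff (i := l - 1) (by omega)).1 h.symm
    omega
  · exact (hp.isPath.getVert_eq_end_iff (i := l + 1) (by omega)).1 h.symm

/-- Of the at least three neighbours of `a`, only the second vertex of the line and possibly `b` lie
on it. -/
theorem IsLine.exists_adj_left_notMem_support [Finite V] (hp : H.IsLine p) :
    ∃ z, H.Adj a z ∧ z ∉ p.support := by
  have hc : ({p.getVert 1, b} : Set V).ncard < (H.neighborSet a).ncard :=
    Set.ncard_pair_le_two.trans_lt hp.pivotal_left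
  obtain ⟨z, hz, hzn⟩ := Set.exists_mem_notMem_of_ncard_lt_ncard hc
  refine ⟨z, hz, fun hs => ?_⟩
  obtain ⟨l, rfl, hl⟩ := Walk.mem_support_iff_exists_getVert.1 hs
  rcases Nat.eq_zero_or_pos l with rfl | h0
  · exact H.ne_of_adj hz p.getVert_zero.symm
  rcases hl.eq_or_lt with rfl | hlt
  · simp at hzn
  · simp [hp.eq_one_of_adj_left h0 hlt hz] at hzn

/-- The vertices of a line strictly between two of its vertices are only adjacent to each other and
to these two. -/
theorem IsLine.exists_of_reachIn [Finite V] (hp : H.IsLine p) {j k l : ℕ} (hk : k ≤ p.length)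
    (hjl : j < l) (hlk : l < k) {z : V}
    (h : H.ReachIn {p.getVert j, p.getVert k}ᶜ (p.getVert l) z) :
    ∃ m, j < m ∧ m < k ∧ z = p.getVert m := by
  refine h.mem_of_closed (C := {z | ∃ m, j < m ∧ m < k ∧ z = p.getVert m}) ?_ ⟨l, hjl, hlk, rfl⟩
  rintro _ ⟨m, hjm, hmk, rfl⟩ w hw hadj
  simp only [Set.mem_compl_iff, Set.mem_insert_iff, Set.mem_singleton_iff, not_or] at hw
  rcases hp.eq_or_eq_of_adj (by omega) (by omega) hadj with rfl | rfl
  · exact ⟨m - 1, by grind, by omega, rfl⟩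
  · exact ⟨m + 1, by omega, by grind, rfl⟩

/-- Two lines of length at most 3 with the same ends and a common interior vertex coincide. -/
theorem IsLine.eq_of_getVert_eq [Finite V] (hp : H.IsLine p) (hq : H.IsLine q) (hpl : p.length < 4)
    (hql : q.length < 4) {s t : ℕ} (hs : 0 < s) (hsp : s < p.length) (ht : 0 < t)
    (htq : t < q.length) (h : p.getVert s = q.getVert t) : q = p := by
  -- The interior of `p` is connected and meets that of `q`, so `p.getVert 1` is interior to `q`;
  -- being adjacent to `a`, it comes first there.
  have h1 : p.getVert 1 = q.getVert 1 := by
    obtain ⟨m, hm0, hm, h1⟩ : ∃ m, 0 < m ∧ m < q.length ∧ p.getVert 1 = q.getVert m := by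
      obtain rfl | rfl : s = 1 ∨ s = 2 := by omega
      · exact ⟨t, ht, htq, h⟩
      · refine hq.exists_of_reachIn le_rfl ht htq (z := p.getVert 1) ?_
        have hmem : ∀ i, 0 < i → i < p.length →
            p.getVert i ∈ ({q.getVert 0, q.getVert q.length}ᶜ : Set V) := fun i h0 hi => by
          simp [hp.isPath.getVert_eq_start_iff hi.le, hp.isPath.getVert_eq_end_iff hi.le, h0.ne',
            hi.ne]
        rw [← h]
        exact .of_adj (p.adj_getVert_succ (i := 1) (by omega)).symm
          (hmem 2 (by omega) (by omega)) (hmem 1 (by omega) (by omega))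
    have hadj := p.adj_getVert_succ (i := 0) (by omega)
    rw [p.getVert_zero, zero_add, h1] at hadj
    rw [h1, hq.eq_one_of_adj_left hm0 hm hadj]
  have h2 : p.getVert 2 = q.getVert 2 := by
    have hadj := q.adj_getVert_succ (i := 1) (by omega)
    rw [← h1] at hadj
    rcases hp.eq_or_eq_of_adj one_pos (by omega) hadj with h | h
    · simp only [Nat.reduceAdd, Nat.sub_self, Walk.getVert_zero] at h
      have := (hq.isPath.getVert_eq_start_iff (i := 2) (by omega)).1 h
      omega
    · exact h.symm
  -- Both lengths are 2 or 3, and the common vertex at position 2 is `b` exactly when the length is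
  -- 2.
  have hlen : q.length = p.length := by
    have e1 := hp.isPath.getVert_eq_end_iff (i := 2) (by omega)
    have e2 := hq.isPath.getVert_eq_end_iff (i := 2) (by omega)
    rw [h2, e2] at e1
    omega
  refine Walk.ext_getVert_le_length hlen fun k hk => ?_
  rcases hk.eq_or_lt with rfl | hk
  · rw [Walk.getVert_length, hlen, Walk.getVert_length]
  · obtain rfl | rfl | rfl : k = 0 ∨ k = 1 ∨ k = 2 := by omega
    · simp
    · exact h1.symm
    · exact h2.symm

/-- By the handshake lemma 2|E| ≤ 2|V| + 2, the excess 2 coming from `a` and `b`. -/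
theorem cycleRank_le_two [Finite V] (h3 : ∀ v, (H.neighborSet v).ncard ≤ 3)
    (h2 : ∀ v, v ≠ a → v ≠ b → (H.neighborSet v).ncard ≤ 2) : H.cycleRank ≤ 2 := by
  classical
  have := Fintype.ofFinite V
  have hdeg : ∀ v, H.degree v = (H.neighborSet v).ncard := fun v => by
    rw [← card_neighborSet_eq_degree, ← Nat.card_eq_fintype_card, Nat.card_coe_set_eq]
  have hE : Nat.card H.edgeSet = H.edgeFinset.card := by
    rw [Nat.card_eq_fintype_card, edgeFinset_card]
  have hle : ∑ v, H.degree v ≤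
      ∑ v, (2 + (if v = a then 1 else 0) + if v = b then 1 else 0) := by
    refine Finset.sum_le_sum fun v _ => ?_
    rw [hdeg]
    have h3v := h3 v
    have h2v := h2 v
    split_ifs with ha hb hb
    · omega
    · exact h3v
    · exact h3v
    · exact h2v ha hb
  rw [sum_degrees_eq_twice_card_edges, Finset.sum_add_distrib, Finset.sum_add_distrib] at hle
  simp only [Finset.sum_const, Finset.card_univ, smul_eq_mul, Finset.sum_ite_eq',
    Finset.mem_univ, if_true] at hle
  rw [cycleRank, hE, Nat.card_eq_fintype_card]
  omega

/-- A graph that consists of two lines between `a` and `b`, and possibly the edge `{a, b}`, has cycle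
rank at most 2. -/
theorem IsLine.cycleRank_le_two [Finite V] (hp : H.IsLine p) (hq : H.IsLine q)
    (h : ∀ v, v ∈ p.support ∨ v ∈ q.support) : H.cycleRank ≤ 2 := by
  have hint : ∀ v, v ≠ a → v ≠ b → ¬ H.IsPivotal v := fun v ha hb =>
    (h v).elim (fun hv => hp.interior v hv ha hb) fun hv => hq.interior v hv ha hb
  have hcase : ∀ v, v ≠ a → v ≠ b → ∃ r : H.Walk a b, (r = p ∨ r = q) ∧ H.IsLine r ∧
      ∃ l, 0 < l ∧ l < r.length ∧ v = r.getVert l := by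
    intro v ha hb
    have key : ∀ r : H.Walk a b, v ∈ r.support → ∃ l, 0 < l ∧ l < r.length ∧ v = r.getVert l := by
      intro r hr
      obtain ⟨l, rfl, hl⟩ := Walk.mem_support_iff_exists_getVert.1 hr
      refine ⟨l, Nat.pos_of_ne_zero ?_, lt_of_le_of_ne hl ?_, rfl⟩
      · rintro rfl
        exact ha r.getVert_zero
      · rintro rfl
        exact hb r.getVert_length
    exact (h v).elim (fun hv => ⟨p, .inl rfl, hp, key p hv⟩) fun hv => ⟨q, .inr rfl, hq, key q hv⟩
  have hthree : ∀ x y z : V, ({x, y, z} : Set V).ncard ≤ 3 := fun x y z =>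
    (Set.ncard_insert_le _ _).trans (Nat.add_le_add_right Set.ncard_pair_le_two 1)
  refine SimpleGraph.cycleRank_le_two (a := a) (b := b) (fun v => ?_) fun v ha hb => ?_
  · by_cases ha : v = a
    · subst ha
      refine (Set.ncard_le_ncard (t := {p.getVert 1, q.getVert 1, b}) fun z hz => ?_).trans
        (hthree _ _ _)
      by_cases hzb : z = b
      · exact .inr (.inr hzb)
      obtain ⟨r, hr, hrl, l, h0, hl, rfl⟩ := hcase z (H.ne_of_adj hz).symm hzb
      rw [hrl.eq_one_of_adj_left h0 hl hz]
      rcases hr with rfl | rfl <;> simp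
    by_cases hb : v = b
    · subst hb
      refine (Set.ncard_le_ncard
        (t := {p.getVert (p.length - 1), q.getVert (q.length - 1), a}) fun z hz => ?_).trans
        (hthree _ _ _)
      by_cases hza : z = a
      · exact .inr (.inr hza)
      obtain ⟨r, hr, hrl, l, h0, hl, rfl⟩ := hcase z hza (H.ne_of_adj hz).symm
      rw [Nat.eq_sub_of_add_eq (hrl.add_one_eq_length_of_adj_right h0 hl hz)]
      rcases hr with rfl | rfl <;> simp
    · exact (not_le.1 (hint v ha hb)).le
  · exact Nat.le_of_lt_succ (not_le.1 (hint v ha hb))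

end Lines

/-! ### The lemma on lines in a block -/

section Main

variable {V : Type*} {G : SimpleGraph V} {B : Set V}

theorem reachIn_induce_compl_pair_iff {u w x y : B} :
    G.ReachIn (B \ {(u : V), (w : V)}) (x : V) y ↔ (G.induce B).ReachIn {u, w}ᶜ x y := by
  rw [reachIn_induce_iff]
  have : ((↑) '' ({u, w}ᶜ : Set B) : Set V) = B \ {(u : V), (w : V)} := by
    ext z; simp [Subtype.ext_iff]; grind
  rw [this]

theorem mem_sdiff_pair_iff {u w x : B} : (x : V) ∈ B \ {(u : V), (w : V)} ↔ x ≠ u ∧ x ≠ w := by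
  simp [Subtype.ext_iff]

end Main

end SimpleGraph

theorem mainTheorem10 {K : Type*} [Field K] {V : Type*} [Finite V] (G : SimpleGraph V)
    (hG : G.IsAccessible K) (B : Set V) (hB : G.IsBlock B) (a b : B)
    (p : (G.induce B).Walk a b) (hp : (G.induce B).IsLine p) (hlen : 2 ≤ p.length) :
    -- exactly one of `a`, `b` is a cutpoint of the block with whiskers
    Xor ((G.blockWithWhiskers B).IsCutpoint (Sum.inl a))
        ((G.blockWithWhiskers B).IsCutpoint (Sum.inl b)) ∧
      p.length < 4 ∧
      -- a line of length 3 has a unique interior cutpoint,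
      -- and it is adjacent to the end of the line that is a cutpoint
      (p.length = 3 →
        (∃! c : B, c ∈ p.support ∧ c ≠ a ∧ c ≠ b ∧
          (G.blockWithWhiskers B).IsCutpoint (Sum.inl c)) ∧
        ∀ c : B, c ∈ p.support → c ≠ a → c ≠ b →
          (G.blockWithWhiskers B).IsCutpoint (Sum.inl c) →
          ((G.blockWithWhiskers B).IsCutpoint (Sum.inl a) → G.Adj a c) ∧
          ((G.blockWithWhiskers B).IsCutpoint (Sum.inl b) → G.Adj b c)) ∧
      -- if the cycle rank of the block is at least 3,
      -- then there is no other line of length 2 or 3 from `a` to `b`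
      (3 ≤ (G.induce B).cycleRank →
        ∀ q : (G.induce B).Walk a b, (G.induce B).IsLine q →
          q.length = 2 ∨ q.length = 3 → q = p) := by
  have hU : ∀ T : Set V, G.IsCutset T → G.numComponents T ≤ T.ncard + G.numComponents ∅ :=
    fun T hT => hG.1.numComponents_le hT
  have hW : ∀ c : B, (G.blockWithWhiskers B).IsCutpoint (Sum.inl c) ↔ G.IsCutpoint (c : V) := by
    intro c
    by_cases h : c = a
    · exact hB.isCutpoint_blockWithWhiskers_iff (c' := b) (h ▸ hp.ne.symm)
    · exact hB.isCutpoint_blockWithWhiskers_iff (c' := a) (Ne.symm h)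
  simp only [hW]
  -- Positions `j` and `k` separate the vertex at `j + 1` from a neighbour `z` of `a` off the line,
  -- so they form a separating pair of the block.
  have hx : ∀ j k, j + 2 ≤ k → k ≤ p.length →
      Xor (G.IsCutpoint (p.getVert j : V)) (G.IsCutpoint (p.getVert k : V)) := by
    intro j k hjk hk
    obtain ⟨z, hz, hzp⟩ := hp.exists_adj_left_notMem_support
    have hzv : ∀ l, z ≠ p.getVert l := fun l h => hzp (h ▸ p.getVert_mem_support l)
    have hne : ∀ {l m}, l ≤ p.length → m ≤ p.length → l ≠ m → p.getVert l ≠ p.getVert m :=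
      fun hl hm h e => h ((hp.getVert_inj hl hm).1 e)
    refine hB.xor_isCutpoint hU hG.2 (p.getVert j).2 (p.getVert k).2 (x₁ := p.getVert (j + 1))
      (x₂ := z) (Subtype.coe_injective.ne (hne (by omega) hk (by omega)))
      (SimpleGraph.mem_sdiff_pair_iff.2 ⟨hne (by omega) (by omega) (by omega),
        hne (by omega) (by omega) (by omega)⟩)
      (SimpleGraph.mem_sdiff_pair_iff.2 ⟨hzv j, hzv k⟩) ?_
    rw [SimpleGraph.reachIn_induce_compl_pair_iff]
    intro h
    obtain ⟨m, -, -, hm⟩ := hp.exists_of_reachIn hk (Nat.lt_succ_self j) (by omega) h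
    exact hzv m hm
  have hxab := hx 0 p.length (by omega) le_rfl
  rw [SimpleGraph.Walk.getVert_zero, SimpleGraph.Walk.getVert_length] at hxab
  -- Among positions 0, 2 and 4 each pair would contain exactly one cutpoint, which is impossible
  -- for three vertices.
  have hlt : p.length < 4 := by
    by_contra! h4
    have h02 := hx 0 2 (by omega) (by omega)
    have h24 := hx 2 4 (by omega) (by omega)
    have h04 := hx 0 4 (by omega) (by omega)
    rw [xor_iff_iff_not] at h02 h24 h04
    by_cases h : G.IsCutpoint (p.getVert 2 : V)
    · exact h02.1 (h04.2 (h24.1 h)) h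
    · exact h (h24.2 (h04.1 (h02.2 h)))
  refine ⟨hxab, hlt, fun h3 => ?_, fun hm q hq hql => ?_⟩
  · have h02 := hx 0 2 (by omega) (by omega)
    have h13 := hx 1 3 (by omega) (by omega)
    have hb3 : p.getVert 3 = b := h3 ▸ p.getVert_length
    rw [SimpleGraph.Walk.getVert_zero] at h02
    rw [hb3] at h13
    have ha1 : G.Adj a (p.getVert 1) := by
      simpa using p.adj_getVert_succ (i := 0) (by omega)
    have hb2 : G.Adj b (p.getVert 2) := by
      have := p.adj_getVert_succ (i := 2) (by omega)
      rw [hb3] at this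
      exact this.symm
    have hint : ∀ l, 0 < l → l < 3 → p.getVert l ≠ a ∧ p.getVert l ≠ b := fun l h0 hl =>
      ⟨fun h => h0.ne' ((hp.isPath.getVert_eq_start_iff (by omega)).1 h),
        fun h => by have := (hp.isPath.getVert_eq_end_iff (by omega)).1 h; omega⟩
    have hsupp : ∀ c ∈ p.support, c ≠ a → c ≠ b → c = p.getVert 1 ∨ c = p.getVert 2 := by
      intro c hc hca hcb
      obtain ⟨l, rfl, hl⟩ := SimpleGraph.Walk.mem_support_iff_exists_getVert.1 hc
      obtain rfl | rfl | rfl | rfl : l = 0 ∨ l = 1 ∨ l = 2 ∨ l = 3 := by omega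
      · exact absurd p.getVert_zero hca
      · exact .inl rfl
      · exact .inr rfl
      · exact absurd hb3 hcb
    -- Together these say that position 1 is a cutpoint exactly when `a` is, and position 2 exactly
    -- when `b` is.
    rw [xor_iff_iff_not] at hxab h02 h13
    constructor
    · by_cases ha : G.IsCutpoint (a : V)
      · refine ⟨p.getVert 1, ⟨p.getVert_mem_support 1, (hint 1 (by omega) (by omega)).1,
          (hint 1 (by omega) (by omega)).2, h13.2 (hxab.1 ha)⟩, ?_⟩
        rintro c ⟨hc, hca, hcb, hcc⟩
        refine (hsupp c hc hca hcb).resolve_right ?_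
        rintro rfl
        exact h02.1 ha hcc
      · refine ⟨p.getVert 2, ⟨p.getVert_mem_support 2, (hint 2 (by omega) (by omega)).1,
          (hint 2 (by omega) (by omega)).2, by_contra fun h => ha (h02.2 h)⟩, ?_⟩
        rintro c ⟨hc, hca, hcb, hcc⟩
        refine (hsupp c hc hca hcb).resolve_left ?_
        rintro rfl
        exact ha (hxab.2 (h13.1 hcc))
    · intro c hc hca hcb hcc
      rcases hsupp c hc hca hcb with rfl | rfl
      · exact ⟨fun _ => ha1, fun h => absurd h (h13.1 hcc)⟩
      · exact ⟨fun h => absurd hcc (h02.1 h), fun _ => hb2⟩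
  · by_contra hqp
    refine absurd (hp.cycleRank_le_two hq fun z => ?_) (by omega)
    -- If a vertex `z` is on neither line, then `z` and the first interior vertices of `p` and `q`
    -- lie in three components of `B \ {a, b}`.
    by_contra! hz
    have hza : z ≠ a := fun h => hz.1 (h ▸ p.start_mem_support)
    have hzb : z ≠ b := fun h => hz.1 (h ▸ p.end_mem_support)
    have hmem : ∀ r : (G.induce B).Walk a b, (G.induce B).IsLine r → 2 ≤ r.length →
        (r.getVert 1 : V) ∈ B \ {(a : V), (b : V)} := fun r hr h2 =>
      SimpleGraph.mem_sdiff_pair_iff.2 ⟨fun h => by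
        have := (hr.isPath.getVert_eq_start_iff (by omega)).1 h; omega, fun h => by
        have := (hr.isPath.getVert_eq_end_iff (by omega)).1 h; omega⟩
    have hreach : ∀ r : (G.induce B).Walk a b, (G.induce B).IsLine r → 2 ≤ r.length →
        ∀ y : B, G.ReachIn (B \ {(a : V), (b : V)}) (r.getVert 1 : V) y →
          ∃ m, 0 < m ∧ m < r.length ∧ y = r.getVert m := fun r hr h2 y h => by
      rw [SimpleGraph.reachIn_induce_compl_pair_iff] at h
      refine hr.exists_of_reachIn le_rfl one_pos h2 ?_
      rwa [SimpleGraph.Walk.getVert_zero, SimpleGraph.Walk.getVert_length]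
    refine hB.false_of_three hU hG.2 a.2 b.2 (Subtype.coe_injective.ne hp.ne)
      (hmem p hp hlen) (hmem q hq (by omega)) (SimpleGraph.mem_sdiff_pair_iff.2 ⟨hza, hzb⟩) ?_ ?_ ?_
    · intro h
      obtain ⟨m, hm0, hml, he⟩ := hreach p hp hlen _ h
      exact hqp (hp.eq_of_getVert_eq hq hlt (by omega) hm0 hml one_pos (by omega) he.symm)
    · intro h
      obtain ⟨m, -, -, rfl⟩ := hreach p hp hlen _ h
      exact hz.1 (p.getVert_mem_support m)
    · intro h
      obtain ⟨m, -, -, rfl⟩ := hreach q hq (by omega) _ h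
      exact hz.2 (q.getVert_mem_support m)
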